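/- Consider three qubits with the Hamiltonian $H=H_1\otimes\mathbf I\otimes\mathbf I+\mathbf I\otimes H_2\otimes\mathbf I+\mathbf I\otimes\mathbf I\otimes H_3$, where $H_l=\sum_{j=0}^{1}(E_l+j\alpha_l)|j\rangle\langle j|$ with $E_l\in\mathbb R$ and $\alpha_l>0$ for $l=1,2,3$. Put $H_{12}=H_1\otimes\mathbf I+\mathbf I\otimes H_2$. For a state $\sigma$ of a system with Hamiltonian $K$ let $W_K(\sigma)=\operatorname{Tr}[\sigma K]-\min_{U}\operatorname{Tr}[U\sigma U^\dagger K]$ (the minimum over all unitaries $U$) be its ergotropy. For a three-qubit state $\rho$ with marginals $\rho_{12}=\operatorname{Tr}_3\rho$ and $\rho_3=\operatorname{Tr}_{12}\rho$ define $$\Delta_{12|3}:=W_H(\rho)-W_{H_{12}}(\rho_{12})-\operatorname{Tr}[\rho_3H_3]+E_g^{3},$$ where $E_g^{3}$ is the least eigenvalue of $H_3$. Suppose $\rho$ is separable across the $12|3$ cut, i.e. $\rho=\sum_i p_i\,|\psi_i\rangle\langle\psi_i|\otimes|\phi_i\rangle\langle\phi_i|$ is a finite mixture ($p_i\ge 0$,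 $\sum_i p_i=1$) with unit vectors $\psi_i\in\mathbb C^2\otimes\mathbb C^2$ (qubits 1, 2) and $\phi_i\in\mathbb C^2$ (qubit 3). Then: 1. if $\alpha_1<\alpha_2=\alpha_3=:\alpha$, then $\Delta_{12|3}\le \dfrac{\alpha_1}{4}$; 2. if $\alpha_1=\alpha_2=:\alpha>\alpha_3$ and $\alpha_3\ge\frac23\alpha$, then $\Delta_{12|3}\le\dfrac{\alpha-\alpha_3}{4}+\dfrac{\alpha}{4}$; 3. if $\alpha_1=\alpha_2=:\alpha>\alpha_3$ and $\alpha_3\le\frac23\alpha$, then $\Delta_{12|3}\le\dfrac{\alpha-\alpha_3}{2}+\dfrac{\alpha}{6}$. -/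

import Mathlib

open scoped Kronecker ComplexOrder

noncomputable section

namespace QubitErgotropy

/-- A density matrix: a positive semidefinite complex matrix of trace one. -/
def IsDensityMatrix {n : Type*} [Fintype n] (ρ : Matrix n n ℂ) : Prop :=
  ρ.PosSemidef ∧ ρ.trace = 1

/-- `ψ` is a unit vector of the Hilbert space `ℂⁿ`. -/
def IsUnitVector {n : Type*} [Fintype n] (ψ : n → ℂ) : Prop :=
  ∑ i, ‖ψ i‖ ^ 2 = 1

/-- The rank-one projector `|ψ⟩⟨ψ|`. -/
def pureState {n : Type*} (ψ : n → ℂ) : Matrix n n ℂ :=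
  Matrix.vecMulVec ψ (star ψ)

/-- `ρ` on `ℂᵃ ⊗ ℂᵇ` is separable across the cut `a` versus `b`: it is a (finite) probabilistic
mixture of product states `|ψᵢ⟩⟨ψᵢ| ⊗ |φᵢ⟩⟨φᵢ|`. -/
def IsSeparable {a b : Type*} [Fintype a] [Fintype b] (ρ : Matrix (a × b) (a × b) ℂ) : Prop :=
  ∃ (k : ℕ) (p : Fin k → ℝ) (ψ : Fin k → a → ℂ) (φ : Fin k → b → ℂ),
    (∀ i, 0 ≤ p i) ∧ ∑ i, p i = 1 ∧
    (∀ i, IsUnitVector (ψ i)) ∧ (∀ i, IsUnitVector (φ i)) ∧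
    ρ = ∑ i, (p i : ℂ) • (pureState (ψ i) ⊗ₖ pureState (φ i))

/-- The marginal on the first factor, `Tr_b ρ`. -/
def marginalFst {a b : Type*} [Fintype b] (ρ : Matrix (a × b) (a × b) ℂ) : Matrix a a ℂ :=
  Matrix.of fun i j => ∑ k, ρ (i, k) (j, k)

/-- The marginal on the second factor, `Tr_a ρ`. -/
def marginalSnd {a b : Type*} [Fintype a] (ρ : Matrix (a × b) (a × b) ℂ) : Matrix b b ℂ :=
  Matrix.of fun i j => ∑ k, ρ (k, i) (k, j)

/-- The mean energy `Tr[ρ H]` (a real number when `ρ` and `H` are Hermitian). -/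
def energy {n : Type*} [Fintype n] (H ρ : Matrix n n ℂ) : ℝ :=
  (ρ * H).trace.re

/-- The least energy `min_U Tr[U ρ U† H]` over all unitaries `U`, that is, the energy of the
passive state of `ρ`. The minimum is attained, see `exists_energy_eq_passiveEnergy`. -/
def passiveEnergy {n : Type*} [Fintype n] [DecidableEq n] (H ρ : Matrix n n ℂ) : ℝ :=
  ⨅ U : Matrix.unitaryGroup n ℂ,
    energy H ((U : Matrix n n ℂ) * ρ * (U : Matrix n n ℂ).conjTranspose)

/-- The ergotropy `W(ρ) = Tr[ρ H] - min_U Tr[U ρ U† H]`. -/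
def ergotropy {n : Type*} [Fintype n] [DecidableEq n] (H ρ : Matrix n n ℂ) : ℝ :=
  energy H ρ - passiveEnergy H ρ

/-- The ground state energy of a Hamiltonian: its least eigenvalue. -/
def groundEnergy {n : Type*} [Fintype n] [DecidableEq n] (H : Matrix n n ℂ) : ℝ :=
  sInf (spectrum ℝ H)

/-- The thermodynamic quantity
`Δ_{X|Xᶜ} = W(ρ) - W(ρ_X) - E(ρ_{Xᶜ}) + E_g^{Xᶜ}` of a state `ρ` on `X ⊗ Xᶜ`, for the global
Hamiltonian `H` and the Hamiltonians `HX`, `HXc` of the two parts. -/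
def thermoGap {a b : Type*} [Fintype a] [Fintype b] [DecidableEq a] [DecidableEq b]
    (H : Matrix (a × b) (a × b) ℂ) (HX : Matrix a a ℂ) (HXc : Matrix b b ℂ)
    (ρ : Matrix (a × b) (a × b) ℂ) : ℝ :=
  ergotropy H ρ - ergotropy HX (marginalFst ρ) - energy HXc (marginalSnd ρ) + groundEnergy HXc

/-- The one-qubit Hamiltonian `∑_{j=0,1} (E + j α) |j⟩⟨j|`. -/
def qubitHamiltonian (E α : ℝ) : Matrix (Fin 2) (Fin 2) ℂ :=
  Matrix.diagonal fun j => ((E + (j : ℕ) * α : ℝ) : ℂ)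

/-- The two-qubit Hamiltonian `H₁ ⊗ 1 + 1 ⊗ H₂`. -/
def hamiltonian₂ (H₁ H₂ : Matrix (Fin 2) (Fin 2) ℂ) :
    Matrix (Fin 2 × Fin 2) (Fin 2 × Fin 2) ℂ :=
  H₁ ⊗ₖ 1 + 1 ⊗ₖ H₂

/-- The three-qubit Hamiltonian `H₁ ⊗ 1 ⊗ 1 + 1 ⊗ H₂ ⊗ 1 + 1 ⊗ 1 ⊗ H₃`, with the tensor factors
bracketed as `(ℂ² ⊗ ℂ²) ⊗ ℂ²`. -/
def hamiltonian₃ (H₁ H₂ H₃ : Matrix (Fin 2) (Fin 2) ℂ) :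
    Matrix ((Fin 2 × Fin 2) × Fin 2) ((Fin 2 × Fin 2) × Fin 2) ℂ :=
  (H₁ ⊗ₖ 1) ⊗ₖ 1 + (1 ⊗ₖ H₂) ⊗ₖ 1 + (1 ⊗ₖ 1) ⊗ₖ H₃

/-- `Δ_{12|3}(ρ)` for three qubits with the local Hamiltonians
`H_l = ∑_j (E_l + j α_l) |j⟩⟨j|`, `l = 1, 2, 3`. -/
def delta12_3 (E₁ E₂ E₃ α₁ α₂ α₃ : ℝ)
    (ρ : Matrix ((Fin 2 × Fin 2) × Fin 2) ((Fin 2 × Fin 2) × Fin 2) ℂ) : ℝ :=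
  thermoGap
    (hamiltonian₃ (qubitHamiltonian E₁ α₁) (qubitHamiltonian E₂ α₂) (qubitHamiltonian E₃ α₃))
    (hamiltonian₂ (qubitHamiltonian E₁ α₁) (qubitHamiltonian E₂ α₂))
    (qubitHamiltonian E₃ α₃) ρ

/-- The unitary matrices form a compact set. -/
theorem isCompact_unitaryGroup (n : Type*) [Fintype n] [DecidableEq n] :
    IsCompact (Matrix.unitaryGroup n ℂ : Set (Matrix n n ℂ)) := by
  have hbox : IsCompact {A : Matrix n n ℂ | A ∈ Set.univ.pi fun _ : n => Set.univ.pi fun _ : n =>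
      Metric.closedBall (0 : ℂ) 1} :=
    isCompact_univ_pi fun _ => isCompact_univ_pi fun _ => isCompact_closedBall _ _
  have hcl : IsClosed (Matrix.unitaryGroup n ℂ : Set (Matrix n n ℂ)) := by
    have h : (Matrix.unitaryGroup n ℂ : Set (Matrix n n ℂ)) =
        {A : Matrix n n ℂ | A * A.conjTranspose = 1} :=
      Set.ext fun A => Matrix.mem_unitaryGroup_iff
    rw [h]
    exact isClosed_eq (continuous_id.matrix_mul continuous_id.matrix_conjTranspose)
      continuous_const
  refine hbox.of_isClosed_subset hcl fun A hA i _ j _ => ?_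
  rw [mem_closedBall_zero_iff]
  exact entry_norm_bound_of_unitary hA i j

/-- The minimum over unitaries in `passiveEnergy` is attained (and is a lower bound). -/
theorem exists_energy_eq_passiveEnergy {n : Type*} [Fintype n] [DecidableEq n]
    (H ρ : Matrix n n ℂ) :
    ∃ U : Matrix.unitaryGroup n ℂ,
      energy H ((U : Matrix n n ℂ) * ρ * (U : Matrix n n ℂ).conjTranspose) = passiveEnergy H ρ ∧
      ∀ V : Matrix.unitaryGroup n ℂ, passiveEnergy H ρ ≤
        energy H ((V : Matrix n n ℂ) * ρ * (V : Matrix n n ℂ).conjTranspose) := by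
  have hc : Continuous fun A : Matrix n n ℂ => energy H (A * ρ * A.conjTranspose) := by
    have h : Continuous fun A : Matrix n n ℂ => A * ρ * A.conjTranspose * H :=
      ((continuous_id.matrix_mul continuous_const).matrix_mul
        continuous_id.matrix_conjTranspose).matrix_mul continuous_const
    exact Complex.continuous_re.comp h.matrix_trace
  have hex : ∃ U ∈ (Matrix.unitaryGroup n ℂ : Set (Matrix n n ℂ)),
      IsMinOn (fun A : Matrix n n ℂ => energy H (A * ρ * A.conjTranspose))
        (Matrix.unitaryGroup n ℂ : Set (Matrix n n ℂ)) U :=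
    (isCompact_unitaryGroup n).exists_isMinOn ⟨1, Submonoid.one_mem _⟩ hc.continuousOn
  refine hex.elim fun U hU => ?_
  have hle : ∀ V : Matrix.unitaryGroup n ℂ,
      energy H (U * ρ * U.conjTranspose) ≤
        energy H ((V : Matrix n n ℂ) * ρ * (V : Matrix n n ℂ).conjTranspose) :=
    fun V => isMinOn_iff.mp hU.2 V.1 V.2
  have hbdd : BddBelow (Set.range fun V : Matrix.unitaryGroup n ℂ =>
      energy H ((V : Matrix n n ℂ) * ρ * (V : Matrix n n ℂ).conjTranspose)) :=
    ⟨_, Set.forall_mem_range.mpr hle⟩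
  exact ⟨⟨U, hU.1⟩, le_antisymm (le_ciInf hle) (ciInf_le hbdd ⟨U, hU.1⟩),
    fun V => ciInf_le hbdd V⟩

/-- The ground state energy of a qubit with `0 ≤ α` is `E`. -/
theorem groundEnergy_qubitHamiltonian (E α : ℝ) (hα : 0 ≤ α) :
    groundEnergy (qubitHamiltonian E α) = E := by
  have h : spectrum ℝ (qubitHamiltonian E α) = {E, E + α} := by
    rw [← spectrum.preimage_algebraMap ℂ, qubitHamiltonian, spectrum_diagonal]
    ext x
    simp only [Set.mem_preimage, Set.mem_range, Fin.exists_fin_two, Complex.coe_algebraMap,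
      Complex.ofReal_inj, Set.mem_insert_iff, Set.mem_singleton_iff]
    simp [eq_comm]
  rw [groundEnergy, h, csInf_pair]
  simpa using hα

end QubitErgotropy

end

/-! The mean energies cancel, so Δ is the passive energy of ρ₁₂ minus that of ρ, plus `E₃`.
Separability enters through majorization: no unitary can make the populations of ρ more concentrated
than the spectrum ν₀ ≥ ν₁ ≥ ν₂ ≥ ν₃ of its marginal (`IsSeparable.exists_substochastic`). The
reason: write ρ = AA† and ρ₁₂ = BB†, where the columns of A are those of B tensored with unit
vectors φᵢ. In the eigenbasis of ρ₁₂, B is √ν times a partial isometry X; a polar decomposition of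
UA supplies a second one, Y. The populations of UρU† are then D ν, and contractivity of X and Y
bounds all row and column sums of D by 1. Only the first two majorization inequalities are needed
(`IsSeparable.le_passiveEnergy`); all remaining weight is charged to the third level. The resulting
bound on Δ is linear in the ν's and is maximised under their ordering and normalisation. -/

namespace QubitErgotropy

open Matrix

/-! ### Partial isometries as contractions -/

/-- A partial isometry between finite-dimensional Hilbert spaces, as a matrix. -/
def IsPartialIsometry {m n : Type*} [Fintype m] [Fintype n] (X : Matrix m n ℂ) : Prop :=
  X * Xᴴ * X = X

section PartialIsometry

variable {m n : Type*} [Fintype m] [Fintype n]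

theorem IsPartialIsometry.transpose {X : Matrix m n ℂ} (hX : IsPartialIsometry X) :
    IsPartialIsometry Xᵀ := by
  have h := congrArg Matrix.transpose hX
  rw [transpose_mul, transpose_mul, ← Matrix.mul_assoc] at h
  exact h

theorem IsPartialIsometry.conjTranspose {X : Matrix m n ℂ} (hX : IsPartialIsometry X) :
    IsPartialIsometry Xᴴ := by
  have h := congrArg Matrix.conjTranspose hX
  rw [conjTranspose_mul, conjTranspose_mul, ← Matrix.mul_assoc] at h
  exact h

theorem star_dotProduct_self_eq_sum_norm_sq (y : n → ℂ) :
    star y ⬝ᵥ y = ((∑ i, ‖y i‖ ^ 2 : ℝ) : ℂ) := by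
  simp [dotProduct, Complex.conj_mul']

/-- Partial isometries are contractions. -/
theorem IsPartialIsometry.sum_norm_sq_mulVec_le {X : Matrix m n ℂ} (hX : IsPartialIsometry X)
    (y : n → ℂ) : ∑ k, ‖∑ i, X k i * y i‖ ^ 2 ≤ ∑ i, ‖y i‖ ^ 2 := by
  classical
  have hP : Xᴴ * X * (Xᴴ * X) = Xᴴ * X := by
    rw [Matrix.mul_assoc, ← Matrix.mul_assoc X, hX]
  -- The complement of the projection X†X is a projection, hence positive semidefinite.
  have hsq : (1 - Xᴴ * X)ᴴ * (1 - Xᴴ * X) = 1 - Xᴴ * X := by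
    rw [conjTranspose_sub, conjTranspose_mul, conjTranspose_conjTranspose, conjTranspose_one,
      Matrix.mul_sub, Matrix.sub_mul, Matrix.sub_mul, hP]
    simp
  have h0 := (posSemidef_conjTranspose_mul_self (1 - Xᴴ * X)).dotProduct_mulVec_nonneg y
  have h1 : star y ⬝ᵥ ((Xᴴ * X) *ᵥ y) = star (X *ᵥ y) ⬝ᵥ (X *ᵥ y) := by
    rw [star_mulVec, ← mulVec_mulVec, dotProduct_mulVec]
  rw [hsq, sub_mulVec, dotProduct_sub, one_mulVec, h1, star_dotProduct_self_eq_sum_norm_sq,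
    star_dotProduct_self_eq_sum_norm_sq, ← Complex.ofReal_sub] at h0
  exact sub_nonneg.mp (Complex.zero_le_real.mp h0)

theorem IsPartialIsometry.sum_norm_sq_col_le {X : Matrix m n ℂ} (hX : IsPartialIsometry X)
    (i : n) : ∑ k, ‖X k i‖ ^ 2 ≤ 1 := by
  classical
  have h := hX.sum_norm_sq_mulVec_le (Pi.single i 1)
  have h2 : ∑ j, ‖(Pi.single i 1 : n → ℂ) j‖ ^ 2 = 1 := by
    rw [Finset.sum_eq_single i] <;> simp +contextual
  rw [h2] at h
  simpa [Pi.single_apply] using h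

end PartialIsometry

/-! ### Singular value and polar decompositions -/

/-- If the rows of `M` are orthogonal, then `M` is a partial isometry followed by a diagonal
matrix. -/
theorem exists_partialIsometry_of_mul_conjTranspose_eq_diagonal {m n : Type*} [Fintype m]
    [Fintype n] [DecidableEq m] {M : Matrix m n ℂ} {r : m → ℝ}
    (h : M * Mᴴ = diagonal fun j => (r j : ℂ)) :
    ∃ X : Matrix m n ℂ, IsPartialIsometry X ∧
      M = diagonal (fun j => (√(r j) : ℂ)) * X ∧
      diagonal (fun j => (√(r j) : ℂ)) * (X * Xᴴ) = diagonal (fun j => (√(r j) : ℂ)) := by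
  have hr : ∀ j, r j = ∑ i, ‖M j i‖ ^ 2 := fun j => by
    have h1 := congrFun (congrFun h j) j
    rw [diagonal_apply_eq, mul_apply] at h1
    have h2 : ((∑ i, ‖M j i‖ ^ 2 : ℝ) : ℂ) = r j := by
      rw [← h1]
      simp [Complex.mul_conj']
    exact_mod_cast h2.symm
  have hr0 : ∀ j, 0 ≤ r j := fun j => by rw [hr j]; positivity
  have ht : ∀ j, (√(r j) : ℂ) * √(r j) = r j := fun j => by
    rw [← Complex.ofReal_mul, Real.mul_self_sqrt (hr0 j)]
  have hM : ∀ j, √(r j) = 0 → ∀ i, M j i = 0 := fun j hj i => by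
    have h1 : r j = 0 := (Real.sqrt_eq_zero (hr0 j)).mp hj
    rw [hr j, Finset.sum_eq_zero_iff_of_nonneg (fun _ _ => by positivity)] at h1
    simpa using h1 i (Finset.mem_univ i)
  -- Since 0⁻¹ = 0, zero rows of `M` become zero rows of X; this is why X is only a partial
  -- isometry.
  set s : m → ℂ := fun j => (√(r j) : ℂ)⁻¹ with hs
  have hss : star s = s := by
    ext j
    simp [hs]
  have hXX : diagonal s * M * (diagonal s * M)ᴴ =
      diagonal fun j => s j * (√(r j) * √(r j)) * s j := by
    rw [conjTranspose_mul, diagonal_conjTranspose, hss, Matrix.mul_assoc, ← Matrix.mul_assoc M, h,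
      diagonal_mul_diagonal, diagonal_mul_diagonal]
    congr 1
    ext j
    rw [ht j, mul_assoc]
  refine ⟨diagonal s * M, ?_, ?_, ?_⟩
  · rw [IsPartialIsometry, hXX, ← Matrix.mul_assoc, diagonal_mul_diagonal]
    congr 2
    ext j
    by_cases hj : (√(r j) : ℂ) = 0
    · simp [hs, hj]
    · simp only [hs]
      field_simp
  · rw [← Matrix.mul_assoc, diagonal_mul_diagonal]
    ext j i
    rw [diagonal_mul]
    by_cases hj : √(r j) = 0
    · simp [hM j hj i]
    · have hj' : (√(r j) : ℂ) ≠ 0 := by exact_mod_cast hj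
      simp [hs, hj']
  · rw [hXX, diagonal_mul_diagonal]
    congr 1
    ext j
    by_cases hj : (√(r j) : ℂ) = 0
    · simp [hj]
    · simp only [hs]
      field_simp

/-- A Hermitian matrix is unitarily diagonalisable, with the eigenvalues in decreasing order along
a given enumeration of the index set. -/
theorem exists_unitary_diagonal_antitone {n : Type*} [Fintype n] [DecidableEq n]
    {M : Matrix n n ℂ} (hM : M.IsHermitian) {d : ℕ} (e : Fin d ≃ n) :
    ∃ (W : unitaryGroup n ℂ) (ν : n → ℝ),
      (W : Matrix n n ℂ) * M * (W : Matrix n n ℂ)ᴴ = diagonal (fun j => (ν j : ℂ)) ∧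
      Antitone (ν ∘ e) := by
  set V : Matrix n n ℂ := (hM.eigenvectorUnitary : Matrix n n ℂ)
  have hVu' : Vᴴ * V = 1 := mem_unitaryGroup_iff'.mp hM.eigenvectorUnitary.2
  have hspec : Vᴴ * M * V = diagonal (fun j => (hM.eigenvalues j : ℂ)) := by
    have h := hM.spectral_theorem
    rw [Unitary.conjStarAlgAut_apply] at h
    have h' : M = V * diagonal (fun j => (hM.eigenvalues j : ℂ)) * Vᴴ := h
    calc Vᴴ * M * V = Vᴴ * (V * diagonal (fun j => (hM.eigenvalues j : ℂ)) * Vᴴ) * V := by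
          rw [← h']
      _ = (Vᴴ * V) * diagonal (fun j => (hM.eigenvalues j : ℂ)) * (Vᴴ * V) := by
          simp only [Matrix.mul_assoc]
      _ = _ := by rw [hVu', Matrix.one_mul, Matrix.mul_one]
  -- `Tuple.sort` sorts increasingly; the sign turns this into decreasing eigenvalues.
  set σ : Equiv.Perm (Fin d) :=
    Tuple.sort (fun i => - hM.eigenvalues (e i)) with hσ
  set τ : Equiv.Perm n := e.symm.trans (σ.trans e) with hτ
  refine ⟨⟨Vᴴ.submatrix τ id, ?_⟩, fun j => hM.eigenvalues (τ j), ?_, ?_⟩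
  · rw [mem_unitaryGroup_iff, star_eq_conjTranspose, conjTranspose_submatrix,
      conjTranspose_conjTranspose, ← submatrix_mul _ _ _ _ _ Function.bijective_id, hVu']
    exact submatrix_one_equiv τ
  · have h1 : Vᴴ.submatrix τ id * M * (Vᴴ.submatrix τ id)ᴴ = (Vᴴ * M * V).submatrix τ τ := by
      ext i j
      simp [mul_apply]
    rw [h1, hspec]
    ext i j
    simp [diagonal_apply]
  · intro i j hij
    have h := Tuple.monotone_sort (fun i => - hM.eigenvalues (e i)) hij
    simpa [hτ, hσ] using h

/-- Up to a partial isometry `Y` on the right, `M` is a square root of `M * Mᴴ`. -/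
theorem exists_partialIsometry_sqrt {m n : Type*} [Fintype m] [Fintype n] [DecidableEq m]
    (M : Matrix m n ℂ) :
    ∃ Y : Matrix n m ℂ, IsPartialIsometry Y ∧ (M * Y)ᴴ * (M * Y) = M * Mᴴ := by
  obtain ⟨Z, r, hZ, -⟩ := exists_unitary_diagonal_antitone (isHermitian_mul_conjTranspose_self M)
    (Fintype.equivFin m).symm
  have hZu : (Z : Matrix m m ℂ) * (Z : Matrix m m ℂ)ᴴ = 1 := mem_unitaryGroup_iff.mp Z.2
  have hZu' : (Z : Matrix m m ℂ)ᴴ * (Z : Matrix m m ℂ) = 1 := mem_unitaryGroup_iff'.mp Z.2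
  generalize (Z : Matrix m m ℂ) = Z at *
  have hd : (Z * M) * (Z * M)ᴴ = diagonal fun j => (r j : ℂ) := by
    rw [← hZ, conjTranspose_mul]
    simp only [Matrix.mul_assoc]
  obtain ⟨X, hX, hMX, hXX⟩ := exists_partialIsometry_of_mul_conjTranspose_eq_diagonal hd
  set T : Matrix m m ℂ := diagonal (fun j => (√(r j) : ℂ)) with hT
  have hTT : Tᴴ = T := by
    rw [hT, diagonal_conjTranspose]
    congr 1
    ext j
    simp
  -- With Y = X†Z, MY = Z†TZ is the positive square root of MM†.
  have hMY : Z * (M * (Xᴴ * Z)) = T * Z := by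
    calc Z * (M * (Xᴴ * Z)) = (Z * M) * Xᴴ * Z := by simp only [Matrix.mul_assoc]
      _ = T * (X * Xᴴ) * Z := by rw [hMX]; simp only [Matrix.mul_assoc]
      _ = T * Z := by rw [hXX]
  have hM' : M * Mᴴ = Zᴴ * (T * T) * Z := by
    have h2 : T * T = (Z * M) * (Z * M)ᴴ := by
      rw [hMX, conjTranspose_mul, hTT, Matrix.mul_assoc, ← Matrix.mul_assoc X, ← Matrix.mul_assoc,
        hXX]
    calc M * Mᴴ = (Zᴴ * Z) * (M * Mᴴ) * (Zᴴ * Z) := by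
          rw [hZu', Matrix.one_mul, Matrix.mul_one]
      _ = Zᴴ * ((Z * M) * (Z * M)ᴴ) * Z := by
          rw [conjTranspose_mul]; simp only [Matrix.mul_assoc]
      _ = _ := by rw [h2]
  refine ⟨Xᴴ * Z, ?_, ?_⟩
  · have hX' := hX.conjTranspose
    rw [IsPartialIsometry, conjTranspose_conjTranspose] at hX'
    rw [IsPartialIsometry, conjTranspose_mul, conjTranspose_conjTranspose]
    calc Xᴴ * Z * (Zᴴ * X) * (Xᴴ * Z) = Xᴴ * (Z * Zᴴ) * X * Xᴴ * Z := by
          simp only [Matrix.mul_assoc]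
      _ = Xᴴ * X * Xᴴ * Z := by rw [hZu, Matrix.mul_one]
      _ = Xᴴ * Z := by rw [hX']
  · calc (M * (Xᴴ * Z))ᴴ * (M * (Xᴴ * Z))
        = (M * (Xᴴ * Z))ᴴ * (Zᴴ * Z) * (M * (Xᴴ * Z)) := by rw [hZu', Matrix.mul_one]
      _ = (Z * (M * (Xᴴ * Z)))ᴴ * (Z * (M * (Xᴴ * Z))) := by
          rw [conjTranspose_mul Z]; simp only [Matrix.mul_assoc]
      _ = Zᴴ * (T * T) * Z := by
          rw [hMY, conjTranspose_mul, hTT]; simp only [Matrix.mul_assoc]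
      _ = M * Mᴴ := hM'.symm

theorem energy_diagonal {n : Type*} [Fintype n] [DecidableEq n] (e : n → ℝ) (σ : Matrix n n ℂ) :
    energy (diagonal fun k => (e k : ℂ)) σ = ∑ k, e k * (σ k k).re := by
  simp [energy, trace, mul_diagonal, Complex.re_sum, mul_comm]

theorem passiveEnergy_le {n : Type*} [Fintype n] [DecidableEq n] (H σ : Matrix n n ℂ)
    (V : unitaryGroup n ℂ) :
    passiveEnergy H σ ≤ energy H ((V : Matrix n n ℂ) * σ * (V : Matrix n n ℂ)ᴴ) := by
  obtain ⟨-, -, h⟩ := exists_energy_eq_passiveEnergy H σ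
  exact h V

/-! ### Majorization for separable states -/

section Separable

variable {a b : Type*} [Fintype a] [Fintype b]

/-- A product ensemble, as a matrix whose columns are the unnormalised states. -/
def productEnsemble {ι : Type*} (B : Matrix a ι ℂ) (φ : ι → b → ℂ) : Matrix (a × b) ι ℂ :=
  of fun x i => B x.1 i * φ i x.2

/-- The weights √pᵢ are absorbed into the first factor. The φᵢ stay normalised, so they disappear
from the partial trace and both states factor through the same index set. -/
theorem IsSeparable.exists_ensemble {ρ : Matrix (a × b) (a × b) ℂ} (h : IsSeparable ρ) :
    ∃ (k : ℕ) (B : Matrix a (Fin k) ℂ) (φ : Fin k → b → ℂ), (∀ i, IsUnitVector (φ i)) ∧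
      ρ = productEnsemble B φ * (productEnsemble B φ)ᴴ ∧ marginalFst ρ = B * Bᴴ := by
  obtain ⟨k, p, ψ, φ, hp, -, -, hφ, rfl⟩ := h
  have hpp : ∀ i, (√(p i) : ℂ) * √(p i) = p i := fun i => by
    rw [← Complex.ofReal_mul, Real.mul_self_sqrt (hp i)]
  refine ⟨k, of fun x i => √(p i) * ψ i x, φ, hφ, ?_, ?_⟩
  · ext x y
    simp only [Matrix.sum_apply, Matrix.smul_apply, kroneckerMap_apply, pureState, vecMulVec_apply, mul_apply,
      productEnsemble, of_apply, conjTranspose_apply, Pi.star_apply, star_mul', smul_eq_mul,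
      ← hpp, Complex.star_def, Complex.conj_ofReal]
    exact Finset.sum_congr rfl fun i _ => by ring
  · have hφ' : ∀ i, ∑ c, φ i c * (starRingEnd ℂ) (φ i c) = 1 := fun i => by
      simp only [Complex.mul_conj']
      exact_mod_cast hφ i
    ext x y
    simp only [marginalFst, Matrix.sum_apply, Matrix.smul_apply, kroneckerMap_apply, pureState, vecMulVec_apply,
      mul_apply, of_apply, conjTranspose_apply, Pi.star_apply, star_mul', smul_eq_mul,
      ← hpp, Complex.star_def, Complex.conj_ofReal]
    rw [Finset.sum_comm]
    refine Finset.sum_congr rfl fun i _ => ?_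
    rw [← mul_one (√(p i) * ψ i x * _), ← hφ' i, Finset.mul_sum]
    exact Finset.sum_congr rfl fun c _ => by ring

variable [DecidableEq b]

theorem productEnsemble_mul_left {ι : Type*} (W : Matrix a a ℂ) (B : Matrix a ι ℂ)
    (φ : ι → b → ℂ) :
    productEnsemble (W * B) φ = (W ⊗ₖ (1 : Matrix b b ℂ)) * productEnsemble B φ := by
  ext x i
  simp only [productEnsemble, of_apply, mul_apply, kroneckerMap_apply, Fintype.sum_prod_type,
    one_apply, mul_ite, mul_one, mul_zero, ite_mul, zero_mul, Finset.sum_ite_eq, Finset.mem_univ,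
    if_true, Finset.sum_mul, mul_assoc]

variable [DecidableEq a]

/-- The populations of a separable state in any orthonormal basis are obtained from the spectrum
of its marginal by a doubly substochastic matrix (Nielsen-Kempe majorization). -/
theorem IsSeparable.exists_substochastic {ρ : Matrix (a × b) (a × b) ℂ} (h : IsSeparable ρ)
    (W : unitaryGroup a ℂ) (ν : a → ℝ)
    (hW : (W : Matrix a a ℂ) * marginalFst ρ * (W : Matrix a a ℂ)ᴴ =
      diagonal fun j => (ν j : ℂ))
    (U : unitaryGroup (a × b) ℂ) :
    ∃ D : (a × b) → a → ℝ, (∀ k j, 0 ≤ D k j) ∧ (∀ k, ∑ j, D k j ≤ 1) ∧ (∀ j, ∑ k, D k j ≤ 1) ∧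
      ∀ k, (((U : Matrix (a × b) (a × b) ℂ) * ρ * (U : Matrix (a × b) (a × b) ℂ)ᴴ) k k).re =
        ∑ j, D k j * ν j := by
  obtain ⟨N, B, φ, hφ, hρ, hρ1⟩ := h.exists_ensemble
  have hWu : (W : Matrix a a ℂ)ᴴ * (W : Matrix a a ℂ) = 1 := mem_unitaryGroup_iff'.mp W.2
  have hUu : (U : Matrix (a × b) (a × b) ℂ)ᴴ * (U : Matrix (a × b) (a × b) ℂ) = 1 :=
    mem_unitaryGroup_iff'.mp U.2
  generalize (W : Matrix a a ℂ) = W at *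
  generalize (U : Matrix (a × b) (a × b) ℂ) = U at *
  have hd : (W * B) * (W * B)ᴴ = diagonal fun j => (ν j : ℂ) := by
    rw [← hW, hρ1, conjTranspose_mul]
    simp only [Matrix.mul_assoc]
  have hν : ∀ j, 0 ≤ ν j := fun j => by
    have h1 := (posSemidef_self_mul_conjTranspose (W * B)).diag_nonneg (i := j)
    rw [hd, diagonal_apply_eq] at h1
    exact Complex.zero_le_real.mp h1
  obtain ⟨X, hX, hBX, -⟩ := exists_partialIsometry_of_mul_conjTranspose_eq_diagonal hd
  obtain ⟨Y, hY, hMY⟩ := exists_partialIsometry_sqrt (U * productEnsemble B φ)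
  have hκ : (W ⊗ₖ (1 : Matrix b b ℂ))ᴴ * (W ⊗ₖ (1 : Matrix b b ℂ)) = 1 := by
    rw [conjTranspose_kronecker, ← mul_kronecker_mul, hWu, conjTranspose_one, Matrix.one_mul,
      one_kronecker_one]
  -- The polar factor Y reverses the order of the product, so U sits inside a Gram matrix and
  -- cancels; the isometry W ⊗ 1 can be inserted there instead.
  have hσ : U * ρ * Uᴴ = (productEnsemble (W * B) φ * Y)ᴴ * (productEnsemble (W * B) φ * Y) := by
    rw [productEnsemble_mul_left]
    generalize W ⊗ₖ (1 : Matrix b b ℂ) = K at *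
    rw [hρ]
    generalize productEnsemble B φ = A at *
    calc U * (A * Aᴴ) * Uᴴ = U * A * (U * A)ᴴ := by
          rw [conjTranspose_mul]; simp only [Matrix.mul_assoc]
      _ = (U * A * Y)ᴴ * (U * A * Y) := hMY.symm
      _ = (A * Y)ᴴ * (Uᴴ * U) * (A * Y) := by
          rw [Matrix.mul_assoc U, conjTranspose_mul]; simp only [Matrix.mul_assoc]
      _ = (A * Y)ᴴ * (Kᴴ * K) * (A * Y) := by rw [hUu, hκ]
      _ = (K * A * Y)ᴴ * (K * A * Y) := by
          rw [Matrix.mul_assoc K, conjTranspose_mul K]; simp only [Matrix.mul_assoc]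
  have hsumφ : ∀ y : Fin N → ℂ, ∑ c, ∑ i, ‖y i * φ i c‖ ^ 2 = ∑ i, ‖y i‖ ^ 2 := fun y => by
    rw [Finset.sum_comm]
    refine Finset.sum_congr rfl fun i _ => ?_
    simp only [norm_mul, mul_pow, ← Finset.mul_sum]
    rw [show ∑ c, ‖φ i c‖ ^ 2 = 1 from hφ i, mul_one]
  -- Once √(ν j) is factored out, this is the squared norm of block j in column k of the Gram
  -- factor. Row sums use that X contracts and that columns of Y have norm at most 1; column sums
  -- exchange the roles of X and Y.
  refine ⟨fun k j => ∑ c, ‖∑ i, X j i * φ i c * Y i k‖ ^ 2, fun k j => by positivity,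
    fun k => ?_, fun j => ?_, fun k => ?_⟩
  · rw [Finset.sum_comm]
    calc ∑ c, ∑ j, ‖∑ i, X j i * φ i c * Y i k‖ ^ 2
        ≤ ∑ c, ∑ i, ‖Y i k * φ i c‖ ^ 2 := Finset.sum_le_sum fun c _ => by
          simpa only [mul_assoc, mul_comm (φ _ c)] using
            hX.sum_norm_sq_mulVec_le fun i => Y i k * φ i c
      _ ≤ 1 := by
          rw [hsumφ]
          exact hY.sum_norm_sq_col_le k
  · rw [Finset.sum_comm]
    calc ∑ c, ∑ k, ‖∑ i, X j i * φ i c * Y i k‖ ^ 2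
        ≤ ∑ c, ∑ i, ‖X j i * φ i c‖ ^ 2 := Finset.sum_le_sum fun c _ => by
          simpa only [transpose_apply, mul_comm (Y _ _)] using
            hY.transpose.sum_norm_sq_mulVec_le fun i => X j i * φ i c
      _ ≤ 1 := by
          rw [hsumφ]
          exact hX.transpose.sum_norm_sq_col_le j
  · have hcol : ∀ x : a × b, (productEnsemble (W * B) φ * Y) x k =
        √(ν x.1) * ∑ i, X x.1 i * φ i x.2 * Y i k := fun x => by
      rw [hBX, mul_apply, Finset.mul_sum]
      refine Finset.sum_congr rfl fun i _ => ?_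
      rw [productEnsemble, of_apply, diagonal_mul]
      ring
    have hkk : (U * ρ * Uᴴ) k k =
        ((∑ x, ‖(productEnsemble (W * B) φ * Y) x k‖ ^ 2 : ℝ) : ℂ) := by
      rw [hσ, mul_apply]
      simp only [conjTranspose_apply, Complex.star_def, Complex.conj_mul']
      push_cast
      rfl
    rw [hkk, Complex.ofReal_re, Fintype.sum_prod_type]
    refine Finset.sum_congr rfl fun j _ => ?_
    rw [Finset.sum_mul]
    refine Finset.sum_congr rfl fun c _ => ?_
    rw [hcol, norm_mul, mul_pow, Complex.norm_real, Real.norm_eq_abs, sq_abs,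
      Real.sq_sqrt (hν j), mul_comm]

/-- A lower bound on the passive energy of a separable state by the two largest eigenvalues of its
marginal and the three lowest energy levels. -/
theorem IsSeparable.le_passiveEnergy {ρ : Matrix (a × b) (a × b) ℂ} (h : IsSeparable ρ)
    (htr : ρ.trace = 1) (W : unitaryGroup a ℂ) {ν : a → ℝ}
    (hW : (W : Matrix a a ℂ) * marginalFst ρ * (W : Matrix a a ℂ)ᴴ =
      diagonal fun j => (ν j : ℂ))
    (hν : ∀ j, 0 ≤ ν j) {i₀ i₁ : a} (h₀ : ∀ j, ν j ≤ ν i₀) (h₁ : ∀ j, j ≠ i₀ → ν j ≤ ν i₁)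
    {e : a × b → ℝ} {k₀ k₁ : a × b} (hk : k₀ ≠ k₁) {ε : ℝ} (h₀₁ : e k₀ ≤ e k₁) (h₁₂ : e k₁ ≤ ε)
    (hε : ∀ k, k ≠ k₀ → k ≠ k₁ → ε ≤ e k) :
    e k₀ * ν i₀ + e k₁ * ν i₁ + ε * (1 - ν i₀ - ν i₁) ≤
      passiveEnergy (diagonal fun k => (e k : ℂ)) ρ := by
  refine le_ciInf fun U => ?_
  obtain ⟨D, hD, hrow, hcol, hq⟩ := h.exists_substochastic W ν hW U
  rw [energy_diagonal]
  have htr' : ∑ k, (((U : Matrix (a × b) (a × b) ℂ) * ρ *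
      (U : Matrix (a × b) (a × b) ℂ)ᴴ) k k).re = 1 := by
    have h1 : ((U : Matrix (a × b) (a × b) ℂ) * ρ *
        (U : Matrix (a × b) (a × b) ℂ)ᴴ).trace = 1 := by
      rw [trace_mul_comm, ← Matrix.mul_assoc, ← star_eq_conjTranspose,
        mem_unitaryGroup_iff'.mp U.2, Matrix.one_mul, htr]
    rw [← Complex.re_sum]
    exact congrArg Complex.re h1
  simp only [hq] at htr' ⊢
  set q : a × b → ℝ := fun k => ∑ j, D k j * ν j with hqdef
  change ∑ k, q k = 1 at htr'
  change _ ≤ ∑ k, e k * q k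
  have hq0 : ∀ k, 0 ≤ q k := fun k => Finset.sum_nonneg fun j _ => mul_nonneg (hD k j) (hν j)
  have hmax : q k₀ ≤ ν i₀ := by
    calc q k₀ ≤ ∑ j, D k₀ j * ν i₀ :=
          Finset.sum_le_sum fun j _ => mul_le_mul_of_nonneg_left (h₀ j) (hD k₀ j)
      _ ≤ ν i₀ := by
          rw [← Finset.sum_mul]
          exact mul_le_of_le_one_left (hν i₀) (hrow k₀)
  -- Two rows have total weight at most 2, charged at ν i₁; the excess ν i₀ - ν i₁ occurs only in
  -- column i₀, whose weight is at most 1.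
  have hpair : q k₀ + q k₁ ≤ ν i₀ + ν i₁ := by
    have hw : D k₀ i₀ + D k₁ i₀ ≤ 1 := by
      rw [← Finset.sum_pair (f := fun k => D k i₀) hk]
      exact (Finset.sum_le_univ_sum_of_nonneg fun k => hD k i₀).trans (hcol i₀)
    have h2 : q k₀ + q k₁ ≤ ∑ j, ((D k₀ j + D k₁ j) * ν i₁ +
        if j = i₀ then (D k₀ i₀ + D k₁ i₀) * (ν i₀ - ν i₁) else 0) := by
      rw [hqdef, ← Finset.sum_add_distrib]
      refine Finset.sum_le_sum fun j _ => ?_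
      split_ifs with hj
      · rw [hj]
        exact le_of_eq (by ring)
      · have := mul_le_mul_of_nonneg_left (h₁ j hj) (add_nonneg (hD k₀ j) (hD k₁ j))
        linarith
    rw [Finset.sum_add_distrib, ← Finset.sum_mul, Finset.sum_add_distrib, Finset.sum_ite_eq',
      if_pos (Finset.mem_univ _)] at h2
    have h3 := mul_le_mul_of_nonneg_right (add_le_add (hrow k₀) (hrow k₁)) (hν i₁)
    have h4 := mul_le_mul_of_nonneg_right hw (sub_nonneg.mpr (h₀ i₁))
    linarith
  have hlow : ε - (ε - e k₀) * q k₀ - (ε - e k₁) * q k₁ ≤ ∑ k, e k * q k := by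
    have h2 : 0 ≤ ∑ k, ((e k - ε) * q k + (if k = k₀ then (ε - e k₀) * q k₀ else 0) +
        (if k = k₁ then (ε - e k₁) * q k₁ else 0)) := by
      refine Finset.sum_nonneg fun k _ => ?_
      by_cases hk0 : k = k₀
      · subst hk0
        rw [if_pos rfl, if_neg hk]
        exact le_of_eq (by ring)
      · by_cases hk1 : k = k₁
        · subst hk1
          rw [if_pos rfl, if_neg hk0]
          exact le_of_eq (by ring)
        · rw [if_neg hk0, if_neg hk1, add_zero, add_zero]
          exact mul_nonneg (sub_nonneg.mpr (hε k hk0 hk1)) (hq0 k)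
    rw [Finset.sum_add_distrib, Finset.sum_add_distrib, Finset.sum_ite_eq', Finset.sum_ite_eq',
      if_pos (Finset.mem_univ _), if_pos (Finset.mem_univ _)] at h2
    simp only [sub_mul, Finset.sum_sub_distrib, ← Finset.mul_sum, htr'] at h2
    linarith
  -- Abel summation: the bound in `hlow` is ε - (e k₁ - e k₀) q k₀ - (ε - e k₁)(q k₀ + q k₁), with
  -- nonnegative coefficients.
  have h5 := mul_le_mul_of_nonneg_left hmax (sub_nonneg.mpr h₀₁)
  have h6 := mul_le_mul_of_nonneg_left hpair (sub_nonneg.mpr h₁₂)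
  linarith

end Separable

/-! ### Three non-interacting qubits -/

theorem hamiltonian₂_eq_diagonal (E₁ E₂ α₁ α₂ : ℝ) :
    hamiltonian₂ (qubitHamiltonian E₁ α₁) (qubitHamiltonian E₂ α₂) = diagonal fun x =>
      ((E₁ + (x.1 : ℕ) * α₁ + (E₂ + (x.2 : ℕ) * α₂) : ℝ) : ℂ) := by
  rw [hamiltonian₂, qubitHamiltonian, qubitHamiltonian, ← diagonal_one,
    diagonal_kronecker_diagonal, diagonal_kronecker_diagonal, diagonal_add]
  simp

theorem hamiltonian₃_eq_diagonal (E₁ E₂ E₃ α₁ α₂ α₃ : ℝ) :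
    hamiltonian₃ (qubitHamiltonian E₁ α₁) (qubitHamiltonian E₂ α₂) (qubitHamiltonian E₃ α₃) =
      diagonal fun x => ((E₁ + (x.1.1 : ℕ) * α₁ + (E₂ + (x.1.2 : ℕ) * α₂) +
        (E₃ + (x.2 : ℕ) * α₃) : ℝ) : ℂ) := by
  rw [hamiltonian₃, qubitHamiltonian, qubitHamiltonian, qubitHamiltonian, ← diagonal_one]
  simp only [diagonal_kronecker_diagonal, diagonal_add]
  simp

/-- For non-interacting qubits the mean energies cancel in `Δ_{12|3}`. -/
theorem delta12_3_eq (E₁ E₂ E₃ α₁ α₂ α₃ : ℝ) (hα₃ : 0 ≤ α₃)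
    (ρ : Matrix ((Fin 2 × Fin 2) × Fin 2) ((Fin 2 × Fin 2) × Fin 2) ℂ) :
    delta12_3 E₁ E₂ E₃ α₁ α₂ α₃ ρ =
      passiveEnergy (diagonal fun x : Fin 2 × Fin 2 =>
        ((E₁ + (x.1 : ℕ) * α₁ + (E₂ + (x.2 : ℕ) * α₂) : ℝ) : ℂ)) (marginalFst ρ) -
      passiveEnergy (diagonal fun x : (Fin 2 × Fin 2) × Fin 2 =>
        ((E₁ + (x.1.1 : ℕ) * α₁ + (E₂ + (x.1.2 : ℕ) * α₂) + (E₃ + (x.2 : ℕ) * α₃) : ℝ) : ℂ)) ρ +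
      E₃ := by
  have h : energy (diagonal fun x : (Fin 2 × Fin 2) × Fin 2 =>
        ((E₁ + (x.1.1 : ℕ) * α₁ + (E₂ + (x.1.2 : ℕ) * α₂) + (E₃ + (x.2 : ℕ) * α₃) : ℝ) : ℂ)) ρ =
      energy (diagonal fun x : Fin 2 × Fin 2 =>
        ((E₁ + (x.1 : ℕ) * α₁ + (E₂ + (x.2 : ℕ) * α₂) : ℝ) : ℂ)) (marginalFst ρ) +
      energy (qubitHamiltonian E₃ α₃) (marginalSnd ρ) := by
    rw [qubitHamiltonian, energy_diagonal, energy_diagonal, energy_diagonal]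
    simp only [marginalFst, marginalSnd, of_apply, Fintype.sum_prod_type, Fin.sum_univ_two,
      Complex.add_re]
    ring
  rw [delta12_3, thermoGap, ergotropy, ergotropy, groundEnergy_qubitHamiltonian E₃ α₃ hα₃,
    hamiltonian₂_eq_diagonal, hamiltonian₃_eq_diagonal, h]
  ring

/-- If the two lowest excitation gaps `β ≤ γ` of the three qubits are known, then `Δ_{12|3}` of a
separable state is bounded by the eigenvalues `ν₀ ≥ ν₁ ≥ ν₂ ≥ ν₃` of its marginal. -/
theorem IsSeparable.exists_delta12_3_le (E₁ E₂ E₃ α₁ α₂ α₃ : ℝ) (hα₃ : 0 ≤ α₃)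
    {ρ : Matrix ((Fin 2 × Fin 2) × Fin 2) ((Fin 2 × Fin 2) × Fin 2) ℂ}
    (hρ : IsDensityMatrix ρ) (hsep : IsSeparable ρ) :
    ∃ ν₀ ν₁ ν₂ ν₃ : ℝ, ν₁ ≤ ν₀ ∧ ν₂ ≤ ν₁ ∧ ν₃ ≤ ν₂ ∧ 0 ≤ ν₃ ∧ ν₀ + ν₁ + ν₂ + ν₃ = 1 ∧
      ∀ (β γ : ℝ) (k : (Fin 2 × Fin 2) × Fin 2), k ≠ 0 → 0 ≤ β → β ≤ γ →
        (k.1.1 : ℕ) * α₁ + (k.1.2 : ℕ) * α₂ + (k.2 : ℕ) * α₃ = β →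
        (∀ l : (Fin 2 × Fin 2) × Fin 2, l ≠ 0 → l ≠ k →
          γ ≤ (l.1.1 : ℕ) * α₁ + (l.1.2 : ℕ) * α₂ + (l.2 : ℕ) * α₃) →
        delta12_3 E₁ E₂ E₃ α₁ α₂ α₃ ρ ≤
          α₁ * ν₁ + α₂ * ν₂ + (α₁ + α₂) * ν₃ - β * ν₁ - γ * (ν₂ + ν₃) := by
  obtain ⟨N, B, φ, -, -, hB⟩ := hsep.exists_ensemble
  have hpsd : (marginalFst ρ).PosSemidef := hB ▸ posSemidef_self_mul_conjTranspose B
  have htr : (marginalFst ρ).trace = 1 := by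
    rw [← hρ.2]
    simp [trace, marginalFst, Fintype.sum_prod_type]
  -- The enumeration is (0,0), (1,0), (0,1), (1,1), the order of increasing energy when α₁ ≤ α₂. Any
  -- order would give a valid upper bound on the passive energy of the marginal.
  obtain ⟨W, ν, hW, hanti⟩ := exists_unitary_diagonal_antitone hpsd.isHermitian
    (finProdFinEquiv.symm.trans (Equiv.prodComm (Fin 2) (Fin 2)))
  have hν : ∀ j, 0 ≤ ν j := fun j => by
    have h1 := (hpsd.mul_mul_conjTranspose_same (W : Matrix _ _ ℂ)).diag_nonneg (i := j)
    rw [hW, diagonal_apply_eq] at h1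
    exact Complex.zero_le_real.mp h1
  have hsum : ∑ j, ν j = 1 := by
    have h1 := congrArg trace hW
    rw [trace_mul_comm, ← Matrix.mul_assoc, ← star_eq_conjTranspose,
      mem_unitaryGroup_iff'.mp W.2, Matrix.one_mul, htr, trace_diagonal] at h1
    exact_mod_cast h1.symm
  have h01 : ν (1, 0) ≤ ν (0, 0) := hanti (show (0 : Fin (2 * 2)) ≤ 1 by decide)
  have h12 : ν (0, 1) ≤ ν (1, 0) := hanti (show (1 : Fin (2 * 2)) ≤ 2 by decide)
  have h23 : ν (1, 1) ≤ ν (0, 1) := hanti (show (2 : Fin (2 * 2)) ≤ 3 by decide)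
  simp only [Fintype.sum_prod_type, Fin.sum_univ_two] at hsum
  refine ⟨ν (0, 0), ν (1, 0), ν (0, 1), ν (1, 1), h01, h12, h23, hν _, by linarith,
    fun β γ k hk hβ hβγ hkβ hl => ?_⟩
  have hup := passiveEnergy_le (diagonal fun x : Fin 2 × Fin 2 =>
    ((E₁ + (x.1 : ℕ) * α₁ + (E₂ + (x.2 : ℕ) * α₂) : ℝ) : ℂ)) (marginalFst ρ) W
  rw [hW, energy_diagonal] at hup
  simp only [diagonal_apply_eq, Complex.ofReal_re, Fintype.sum_prod_type, Fin.sum_univ_two,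
    Fin.val_zero, Fin.val_one, Nat.cast_zero, Nat.cast_one, zero_mul, one_mul] at hup
  have hlow := hsep.le_passiveEnergy hρ.2 W hW hν (i₀ := (0, 0)) (i₁ := (1, 0))
    (by
      rintro ⟨i, j⟩
      fin_cases i <;> fin_cases j <;> simp only [Fin.zero_eta, Fin.mk_one, Fin.isValue] <;>
        linarith)
    (by
      rintro ⟨i, j⟩ hij
      fin_cases i <;> fin_cases j <;> simp only [Fin.zero_eta, Fin.mk_one, Fin.isValue] at hij ⊢ <;>
        first | linarith | exact absurd rfl hij)
    (e := fun x => E₁ + (x.1.1 : ℕ) * α₁ + (E₂ + (x.1.2 : ℕ) * α₂) + (E₃ + (x.2 : ℕ) * α₃))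
    (k₀ := 0) (k₁ := k) hk.symm (ε := E₁ + E₂ + E₃ + γ)
    (by simp; linarith) (by linarith)
    (fun l hl0 hlk => by linarith [hl l hl0 hlk])
  have h0 : E₁ + (((0 : (Fin 2 × Fin 2) × Fin 2).1.1 : ℕ) : ℝ) * α₁ +
      (E₂ + (((0 : (Fin 2 × Fin 2) × Fin 2).1.2 : ℕ) : ℝ) * α₂) +
      (E₃ + (((0 : (Fin 2 × Fin 2) × Fin 2).2 : ℕ) : ℝ) * α₃) = E₁ + E₂ + E₃ := by simp
  have hk' : E₁ + ((k.1.1 : ℕ) : ℝ) * α₁ + (E₂ + ((k.1.2 : ℕ) : ℝ) * α₂) +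
      (E₃ + ((k.2 : ℕ) : ℝ) * α₃) = E₁ + E₂ + E₃ + β := by linarith
  rw [h0, hk'] at hlow
  rw [delta12_3_eq E₁ E₂ E₃ α₁ α₂ α₃ hα₃]
  have hν0 : ν (0, 0) = 1 - ν (1, 0) - ν (0, 1) - ν (1, 1) := by linarith
  rw [hν0] at hup hlow
  linarith

end QubitErgotropy

theorem proposition3 (E₁ E₂ E₃ α₁ α₂ α₃ : ℝ) (hα₁ : 0 < α₁) (hα₂ : 0 < α₂) (hα₃ : 0 < α₃)
    (ρ : Matrix ((Fin 2 × Fin 2) × Fin 2) ((Fin 2 × Fin 2) × Fin 2) ℂ)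
    (hρ : QubitErgotropy.IsDensityMatrix ρ) (hsep : QubitErgotropy.IsSeparable ρ) :
    (∀ α : ℝ, α₁ < α → α₂ = α → α₃ = α →
      QubitErgotropy.delta12_3 E₁ E₂ E₃ α₁ α₂ α₃ ρ ≤ α₁ / 4) ∧
    (∀ α : ℝ, α₁ = α → α₂ = α → α₃ < α → 2 / 3 * α ≤ α₃ →
      QubitErgotropy.delta12_3 E₁ E₂ E₃ α₁ α₂ α₃ ρ ≤ (α - α₃) / 4 + α / 4) ∧
    (∀ α : ℝ, α₁ = α → α₂ = α → α₃ < α → α₃ ≤ 2 / 3 * α →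
      QubitErgotropy.delta12_3 E₁ E₂ E₃ α₁ α₂ α₃ ρ ≤ (α - α₃) / 2 + α / 6) := by
  obtain ⟨ν₀, ν₁, ν₂, ν₃, h01, h12, h23, h3, hsum, hle⟩ :=
    hsep.exists_delta12_3_le E₁ E₂ E₃ α₁ α₂ α₃ hα₃.le hρ
  -- This bound needs no comparison of α₃ with 2α/3 and serves both remaining cases.
  have hequal : ∀ α : ℝ, α₁ = α → α₂ = α → α₃ < α →
      QubitErgotropy.delta12_3 E₁ E₂ E₃ α₁ α₂ α₃ ρ ≤ (α - α₃) / 4 + α / 4 := by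
    rintro α rfl rfl hα
    have h := hle α₃ α₂ ((0, 0), 1) (by decide) hα₃.le hα.le (by simp) (by
      rintro ⟨⟨i, j⟩, k⟩
      fin_cases i <;> fin_cases j <;> fin_cases k <;> simp <;> linarith)
    -- The bound is (α - α₃)(ν₁ + ν₃) + α₃ν₃, and the ordering forces ν₁ + ν₃ ≤ 1/2 and ν₃ ≤ 1/4.
    nlinarith [mul_nonneg (sub_nonneg.mpr hα.le)
      (show 0 ≤ 1 / 2 - ν₁ - ν₃ by linarith), mul_nonneg hα₃.le
      (show 0 ≤ 1 / 4 - ν₃ by linarith)]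
  refine ⟨?_, fun α h1 h2 h3 _ => hequal α h1 h2 h3, fun α h1 h2 h3 h4 => ?_⟩
  · rintro α hα rfl rfl
    -- The lowest excitation is that of qubit 1; everything but α₁ν₃ cancels.
    have h := hle α₁ α₃ ((1, 0), 0) (by decide) hα₁.le hα.le (by simp) (by
      rintro ⟨⟨i, j⟩, k⟩
      fin_cases i <;> fin_cases j <;> fin_cases k <;> simp <;> linarith)
    nlinarith [mul_nonneg hα₁.le (show 0 ≤ 1 / 4 - ν₃ by linarith)]
  -- The claimed bound exceeds `hequal` by (2α/3 - α₃)/4, which is nonnegative here.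
  · have := hequal α h1 h2 h3
    linarith
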